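/- For an $n\times d$ real matrix $A$ with rows $A_1,\dots,A_n$, let $\gamma_A=\max_{\|\mathbf w\|_2\le 1}\min_{\mathbf p\in\Delta^{n-1}}\mathbf p^\top A\mathbf w$ be its margin, where $\Delta^{n-1}$ is the probability simplex in $\mathbb R^n$; note that $\min_{\mathbf p\in\Delta^{n-1}}\mathbf p^\top A\mathbf w=\min_{l}(A\mathbf w)_l$. A deterministic two-sided algorithm interacts with $A$ in rounds: in round $t$ it chooses $\mathbf p_t\in\mathbb R^n$ and $\mathbf w_t\in\mathbb R^d$ as (arbitrary) functions of the previous responses, and receives $\mathbf p_t^\top A$ and $A\mathbf w_t$. After $T$ rounds it returns a vector $\mathbf w_{T+1}\in\mathbb R^d$ that is a function of all $T$ responses. There is a universal constant $c>0$ such that the following two statements hold. (i) Let $T>c$ be an integer, $d>cT$ and $n>cT^2\log T$. For every deterministic two-sided algorithm there is an $n\times d$ matrix $A$ with $$\max_{l}\|A_l\|_2\le 1\quad\text{and}\quad \gamma_A\ \ge\ \frac{1}{c\,T\sqrt{T\log n}},$$ such that the vector $\mathbf w_{T+1}$ returned by the algorithm after $T$ rounds of interaction with $A$ satisfies $\min_{\mathbf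 p\in\Delta^{n-1}}\mathbf p^\top A\mathbf w_{T+1}\le 0$. (ii) Consequently, let $0<\gamma\le 1/c$, $d>c\,\gamma^{-2/3}$ and $n>c\,\gamma^{-4/3}\log(1/\gamma)$. If a deterministic two-sided algorithm that runs for $T\ge 0$ rounds returns, for every $n\times d$ matrix $A$ with rows of Euclidean norm at most $1$ and $\gamma_A\ge\gamma$, a linear separator (that is, $\min_{\mathbf p\in\Delta^{n-1}}\mathbf p^\top A\mathbf w_{T+1}>0$), then $T\ge \frac1c\,\gamma^{-2/3}(\log n)^{-1/3}$. -/

import Mathlib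

open Matrix Real

/-- The Euclidean norm of a real vector. -/
noncomputable def euclNorm {m : ℕ} (v : Fin m → ℝ) : ℝ := ‖WithLp.toLp 2 v‖

/-- `min_{p ∈ Δ^{n-1}} pᵀ A w`, where `Δ^{n-1}` is the probability simplex. -/
noncomputable def minPayoff {n d : ℕ} (A : Matrix (Fin n) (Fin d) ℝ) (w : Fin d → ℝ) : ℝ :=
  sInf ((fun p : Fin n → ℝ => p ⬝ᵥ (A *ᵥ w)) '' stdSimplex ℝ (Fin n))

/-- The margin `γ_A = max_{‖w‖₂ ≤ 1} min_{p ∈ Δ^{n-1}} pᵀ A w`. -/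
noncomputable def margin {n d : ℕ} (A : Matrix (Fin n) (Fin d) ℝ) : ℝ :=
  sSup (minPayoff A '' {w : Fin d → ℝ | euclNorm w ≤ 1})

/-- The minimum in `minPayoff` is attained. -/
theorem minPayoff_isLeast {n d : ℕ} [NeZero n] (A : Matrix (Fin n) (Fin d) ℝ) (w : Fin d → ℝ) :
    IsLeast ((fun p : Fin n → ℝ => p ⬝ᵥ (A *ᵥ w)) '' stdSimplex ℝ (Fin n)) (minPayoff A w) := by
  refine IsCompact.isLeast_sInf ?_ ?_
  · exact (isCompact_stdSimplex ℝ (Fin n)).image (by fun_prop)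
  · exact ⟨_, _, single_mem_stdSimplex ℝ (0 : Fin n), rfl⟩

/-- `min_{p ∈ Δ^{n-1}} pᵀ A w = min_l (A w)_l`. -/
theorem minPayoff_eq_iInf {n d : ℕ} [NeZero n] (A : Matrix (Fin n) (Fin d) ℝ) (w : Fin d → ℝ) :
    minPayoff A w = ⨅ l, (A *ᵥ w) l := by
  obtain ⟨⟨p, hp, hpe⟩, hl⟩ := minPayoff_isLeast A w
  apply le_antisymm
  · refine le_ciInf fun l => hl ⟨Pi.single l 1, single_mem_stdSimplex ℝ l, ?_⟩
    simp
  · rw [← hpe]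
    calc (⨅ l, (A *ᵥ w) l) = ∑ i, p i * (⨅ l, (A *ᵥ w) l) := by
          rw [← Finset.sum_mul, hp.2, one_mul]
      _ ≤ ∑ i, p i * (A *ᵥ w) i := Finset.sum_le_sum fun i _ =>
          mul_le_mul_of_nonneg_left (ciInf_le (Set.finite_range _).bddBelow i) (hp.1 i)

/-- The maximum in `margin` is attained. -/
theorem margin_isGreatest {n d : ℕ} (A : Matrix (Fin n) (Fin d) ℝ) :
    IsGreatest (minPayoff A '' {w : Fin d → ℝ | euclNorm w ≤ 1}) (margin A) := by
  refine IsCompact.isGreatest_sSup ?_ ⟨_, 0, by simp [euclNorm], rfl⟩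
  refine IsCompact.image ?_ ?_
  · have h : {w : Fin d → ℝ | euclNorm w ≤ 1} =
        WithLp.ofLp '' Metric.closedBall (0 : EuclideanSpace ℝ (Fin d)) 1 := by
      ext w
      constructor
      · intro hw
        exact ⟨WithLp.toLp 2 w, by simpa [euclNorm] using hw, rfl⟩
      · rintro ⟨v, hv, rfl⟩
        simpa [euclNorm] using hv
    rw [h]
    exact (isCompact_closedBall _ _).image (PiLp.continuous_ofLp 2 _)
  · exact (isCompact_stdSimplex ℝ (Fin n)).continuous_sInf
      (f := fun (w : Fin d → ℝ) (p : Fin n → ℝ) => p ⬝ᵥ (A *ᵥ w)) (by fun_prop)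

/-- The two-sided oracle: on a query `(p, w)` it returns `(pᵀ A, A w)`. -/
def twoSidedOracle {n d : ℕ} (A : Matrix (Fin n) (Fin d) ℝ)
    (q : (Fin n → ℝ) × (Fin d → ℝ)) : (Fin d → ℝ) × (Fin n → ℝ) :=
  (q.1 ᵥ* A, A *ᵥ q.2)

/-- A deterministic algorithm for `n × d` matrices with two-sided oracle access. Its next query
and its output are arbitrary functions of the list of oracle responses received so far
(oldest first). -/
structure TwoSidedAlgorithm (n d : ℕ) where
  query : List ((Fin d → ℝ) × (Fin n → ℝ)) → (Fin n → ℝ) × (Fin d → ℝ)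
  output : List ((Fin d → ℝ) × (Fin n → ℝ)) → (Fin d → ℝ)

/-- The responses received in the first `t` rounds of interaction with the oracle for `A`. -/
def TwoSidedAlgorithm.responses {n d : ℕ} (alg : TwoSidedAlgorithm n d)
    (A : Matrix (Fin n) (Fin d) ℝ) : ℕ → List ((Fin d → ℝ) × (Fin n → ℝ))
  | 0 => []
  | t + 1 => alg.responses A t ++ [twoSidedOracle A (alg.query (alg.responses A t))]

/-- The vector `w_{T+1}` returned after `T` rounds of interaction with the oracle for `A`. -/
def TwoSidedAlgorithm.result {n d : ℕ} (alg : TwoSidedAlgorithm n d)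
    (A : Matrix (Fin n) (Fin d) ℝ) (T : ℕ) : Fin d → ℝ :=
  alg.output (alg.responses A T)

/-! An adversary builds `A = ∑ u_s v_sᵀ`, `s ≤ T`, adaptively, with orthonormal `v_s` and with `u_s`
the increments of a chain `a·1 + b ξ_s` ending at `ξ_T = 0`. The increments telescope to `a·1`, so
the normalised sum of the `v_s` has margin `a / √(T+1)`.

Before answering round `t`, the adversary knows that round's query. It picks `v_t` orthogonal to all
column-side queries so far and `ξ_t` orthogonal to all row-side ones, so every later term of the sum
is invisible in the answers already given. The last `v_T` is also orthogonal to the output `w`,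
hence `A w` lies in the span of `u_0, …, u_{T-1}`.

The `ξ_s` are mutually orthogonal, orthogonal to `1` and of squared norm `n/2`. With `S = ∑ ξ_s` and
`a = b / (2R)`, the vector `(1 - S/R)/n` is therefore orthogonal to all those `u_s`; it is a
distribution once `S ≤ R` coordinatewise, and then `w` does not separate. Keeping each `ξ_s`
orthogonal to the exponential weights of the current partial sum gives this for `R = √(2T log n)`,
as a random walk would. The key lemmas are `exists_large_cube_vector`, `sum_exp_add_le`,
`IsResistingChain.exists_succ` and `dotProduct_chainIncrement_eq_zero`. -/

/-! ### Orthogonal vectors in the cube and the exponential potential. -/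

theorem exists_ne_zero_orthogonal {m : ℕ} (F : Finset (Fin m → ℝ)) (hF : F.card < m) :
    ∃ v : Fin m → ℝ, v ≠ 0 ∧ ∀ f ∈ F, f ⬝ᵥ v = 0 := by
  let Φ : (Fin m → ℝ) →ₗ[ℝ] (F → ℝ) := LinearMap.pi fun f => dotProductBilin ℝ ℝ f.1
  have hker : LinearMap.ker Φ ≠ ⊥ := LinearMap.ker_ne_bot_of_finrank_lt (by simpa using hF)
  obtain ⟨v, hv, hv0⟩ := Submodule.exists_mem_ne_zero_of_ne_bot hker
  refine ⟨v, hv0, fun f hf => ?_⟩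
  have h := congrFun (LinearMap.mem_ker.1 hv) ⟨f, hf⟩
  simpa [Φ] using h

theorem exists_unit_orthogonal {m : ℕ} (F : Finset (Fin m → ℝ)) (hF : F.card < m) :
    ∃ v : Fin m → ℝ, v ⬝ᵥ v = 1 ∧ ∀ f ∈ F, f ⬝ᵥ v = 0 := by
  obtain ⟨v, hv0, hv⟩ := exists_ne_zero_orthogonal F hF
  have hpos : 0 < v ⬝ᵥ v :=
    lt_of_le_of_ne (by simpa using dotProduct_star_self_nonneg v)
      (fun h => hv0 (dotProduct_self_eq_zero.1 h.symm))
  refine ⟨(√(v ⬝ᵥ v))⁻¹ • v, ?_, fun f hf => by simp [hv f hf]⟩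
  rw [smul_dotProduct, dotProduct_smul, smul_eq_mul, smul_eq_mul, ← mul_assoc, ← mul_inv,
    Real.mul_self_sqrt hpos.le, inv_mul_cancel₀ hpos.ne']

/-- A subspace of codimension `k` contains a vector of the cube `[-1, 1]^m` whose squared norm is
at least `m - k`. -/
theorem exists_large_cube_vector {m : ℕ} (F : Finset (Fin m → ℝ)) :
    ∃ x : Fin m → ℝ, (∀ f ∈ F, f ⬝ᵥ x = 0) ∧ (∀ l, |x l| ≤ 1) ∧ (m : ℝ) - F.card ≤ x ⬝ᵥ x := by
  let K : Set (Fin m → ℝ) := {x | ∀ f ∈ F, f ⬝ᵥ x = 0} ∩ Set.Icc (fun _ => -1) (fun _ => 1)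
  have hKc : IsCompact K := by
    refine isCompact_Icc.inter_left ?_
    simp only [Set.ofPred_forall]
    exact isClosed_biInter fun f _ => isClosed_eq (by fun_prop) continuous_const
  have hK0 : (0 : Fin m → ℝ) ∈ K := ⟨fun f _ => by simp, fun _ => by simp, fun _ => by simp⟩
  obtain ⟨x, ⟨hxF, hxl, hxu⟩, hmax⟩ :=
    hKc.exists_isMaxOn ⟨0, hK0⟩ (f := fun x => x ⬝ᵥ x) (by fun_prop)
  have hx1 : ∀ l, |x l| ≤ 1 := fun l => abs_le.2 ⟨hxl l, hxu l⟩
  refine ⟨x, hxF, hx1, ?_⟩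
  by_contra! hlt
  -- A norm maximiser with too few saturated coordinates could still move in a direction that fixes
  -- them and respects `F`.
  let J : Finset (Fin m) := Finset.univ.filter fun l => |x l| = 1
  have hJ : (J.card : ℝ) ≤ x ⬝ᵥ x := by
    calc (J.card : ℝ) = ∑ l ∈ J, x l * x l := by
          rw [Finset.sum_congr rfl (g := fun _ => (1 : ℝ))]
          · simp
          · intro l hl
            rw [← abs_mul_abs_self, (Finset.mem_filter.1 hl).2, one_mul]
      _ ≤ x ⬝ᵥ x := Finset.sum_le_sum_of_subset_of_nonneg (Finset.subset_univ _)
          fun _ _ _ => mul_self_nonneg _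
  have hcard : (F ∪ J.image fun l => Pi.single l (1 : ℝ)).card < m := by
    have h1 := Finset.card_union_le F (J.image fun l => Pi.single l (1 : ℝ))
    have h2 : (J.image fun l => Pi.single l (1 : ℝ)).card ≤ J.card := Finset.card_image_le
    have h3 : (F.card : ℝ) + J.card < m := by linarith
    have h4 : F.card + J.card < m := by exact_mod_cast h3
    omega
  -- The sign of `y` is chosen so that a small step along it increases the norm.
  obtain ⟨y, hy0, hy⟩ : ∃ y : Fin m → ℝ, y ≠ 0 ∧ (∀ f ∈ F, f ⬝ᵥ y = 0) ∧
      (∀ l ∈ J, y l = 0) ∧ 0 ≤ x ⬝ᵥ y := by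
    obtain ⟨y, hy0, hy⟩ := exists_ne_zero_orthogonal _ hcard
    have hyF : ∀ f ∈ F, f ⬝ᵥ y = 0 := fun f hf => hy f (Finset.mem_union_left _ hf)
    have hyJ : ∀ l ∈ J, y l = 0 := fun l hl => by
      simpa using hy _ (Finset.mem_union_right _ (Finset.mem_image_of_mem _ hl))
    rcases le_total 0 (x ⬝ᵥ y) with h | h
    · exact ⟨y, hy0, hyF, hyJ, h⟩
    · exact ⟨-y, by simpa using hy0, fun f hf => by simp [hyF f hf],
        fun l hl => by simp [hyJ l hl], by simpa using h⟩
  obtain ⟨hyF, hyJ, hxy⟩ := hy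
  have hev : ∀ᶠ ε : ℝ in nhdsWithin 0 (Set.Ioi 0), ∀ l, |x l + ε * y l| ≤ 1 := by
    refine Filter.eventually_all.2 fun l => ?_
    by_cases hl : l ∈ J
    · exact Filter.Eventually.of_forall fun ε => by simpa [hyJ l hl] using hx1 l
    · have hlt1 : |x l| < 1 :=
        lt_of_le_of_ne (hx1 l) fun h => hl (Finset.mem_filter.2 ⟨Finset.mem_univ _, h⟩)
      have hc : Continuous fun ε : ℝ => |x l + ε * y l| := by fun_prop
      refine Filter.Eventually.filter_mono nhdsWithin_le_nhds ?_
      filter_upwards [hc.continuousAt.eventually_lt (x₀ := 0) (g := fun _ => 1)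
        continuousAt_const (by simpa using hlt1)] with ε hε using hε.le
  obtain ⟨ε, hε1, hε⟩ := (hev.and self_mem_nhdsWithin).exists
  have hε0 : 0 < ε := hε
  have hmem : x + ε • y ∈ K := by
    refine ⟨fun f hf => by simp [dotProduct_add, hxF f hf, hyF f hf], fun l => ?_, fun l => ?_⟩
    · exact (abs_le.1 (hε1 l)).1
    · exact (abs_le.1 (hε1 l)).2
  have hle : (x + ε • y) ⬝ᵥ (x + ε • y) ≤ x ⬝ᵥ x := hmax hmem
  have hypos : 0 < y ⬝ᵥ y :=
    lt_of_le_of_ne (by simpa using dotProduct_star_self_nonneg y)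
      (fun h => hy0 (dotProduct_self_eq_zero.1 h.symm))
  simp only [dotProduct_add, add_dotProduct, smul_dotProduct, dotProduct_smul, smul_eq_mul,
    dotProduct_comm y x] at hle
  have h1 : 0 ≤ ε * (x ⬝ᵥ y) := by positivity
  have h2 : 0 < ε * (ε * (y ⬝ᵥ y)) := by positivity
  linarith

theorem exists_cube_vector_of_sq_norm {m : ℕ} (F : Finset (Fin m → ℝ)) {r : ℝ} (hr0 : 0 < r)
    (hr : r ≤ m - F.card) :
    ∃ x : Fin m → ℝ, (∀ f ∈ F, f ⬝ᵥ x = 0) ∧ (∀ l, |x l| ≤ 1) ∧ x ⬝ᵥ x = r := by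
  obtain ⟨x, hxF, hx1, hx⟩ := exists_large_cube_vector F
  have hs : r ≤ x ⬝ᵥ x := hr.trans hx
  have hpos : 0 < x ⬝ᵥ x := hr0.trans_le hs
  refine ⟨√(r / (x ⬝ᵥ x)) • x, fun f hf => by simp [hxF f hf], fun l => ?_, ?_⟩
  · have h1 : √(r / (x ⬝ᵥ x)) ≤ 1 := Real.sqrt_le_one.2 ((div_le_one hpos).2 hs)
    rw [Pi.smul_apply, smul_eq_mul, abs_mul, abs_of_nonneg (Real.sqrt_nonneg _)]
    exact mul_le_one₀ h1 (abs_nonneg _) (hx1 l)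
  · rw [smul_dotProduct, dotProduct_smul, smul_eq_mul, smul_eq_mul, ← mul_assoc,
      Real.mul_self_sqrt (by positivity), div_mul_cancel₀ _ hpos.ne']

/-- The exponential potential of a walk in `ℝ^m` grows by at most `exp (β² / 2)` in a step of
the cube `[-1, 1]^m` orthogonal to its weights. -/
theorem sum_exp_add_le {m : ℕ} (β : ℝ) (S x : Fin m → ℝ) (hx : ∀ l, |x l| ≤ 1)
    (horth : (fun l => exp (β * S l)) ⬝ᵥ x = 0) :
    ∑ l, exp (β * (S l + x l)) ≤ exp (β ^ 2 / 2) * ∑ l, exp (β * S l) := by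
  calc ∑ l, exp (β * (S l + x l))
      ≤ ∑ l, exp (β * S l) * (cosh β + x l * sinh β) := by
        refine Finset.sum_le_sum fun l _ => ?_
        rw [mul_add, Real.exp_add, mul_comm β (x l)]
        -- By convexity, `exp` lies below its chord over `[-β, β]`; the term linear in `x` then
        -- cancels by orthogonality.
        exact mul_le_mul_of_nonneg_left (exp_mul_le_cosh_add_mul_sinh (hx l) β) (exp_pos _).le
    _ = cosh β * ∑ l, exp (β * S l) + sinh β * ((fun l => exp (β * S l)) ⬝ᵥ x) := by
        simp only [dotProduct, Finset.mul_sum, ← Finset.sum_add_distrib]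
        exact Finset.sum_congr rfl fun l _ => by ring
    _ = cosh β * ∑ l, exp (β * S l) := by rw [horth, mul_zero, add_zero]
    _ ≤ _ := mul_le_mul_of_nonneg_right (cosh_le_exp_half_sq β)
        (Finset.sum_nonneg fun _ _ => (exp_pos _).le)

/-! ### Adaptive construction of the hidden chain. -/

/-- The query in round `r` (counted from `0`) of the interaction with the oracle for `A`. -/
def TwoSidedAlgorithm.queryAt {n d : ℕ} (alg : TwoSidedAlgorithm n d)
    (A : Matrix (Fin n) (Fin d) ℝ) (r : ℕ) : (Fin n → ℝ) × (Fin d → ℝ) :=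
  alg.query (alg.responses A r)

/-- By induction on rounds: equal responses force equal queries, so orthogonality to the queries
made against `A` alone suffices. -/
theorem TwoSidedAlgorithm.responses_add_vecMulVec {n d : ℕ} (alg : TwoSidedAlgorithm n d)
    (A : Matrix (Fin n) (Fin d) ℝ) (u : Fin n → ℝ) (v : Fin d → ℝ) (t : ℕ)
    (hu : ∀ r < t, (alg.queryAt A r).1 ⬝ᵥ u = 0)
    (hv : ∀ r < t, (alg.queryAt A r).2 ⬝ᵥ v = 0) :
    alg.responses (A + vecMulVec u v) t = alg.responses A t := by
  induction t with
  | zero => rfl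
  | succ t ih =>
    have h := ih (fun r hr => hu r (by omega)) (fun r hr => hv r (by omega))
    have h1 := hu t (by omega)
    have h2 := hv t (by omega)
    simp only [TwoSidedAlgorithm.queryAt] at h1 h2
    simp only [TwoSidedAlgorithm.responses, h, twoSidedOracle, vecMul_add, add_mulVec,
      vecMul_vecMulVec, vecMulVec_mulVec, h1, dotProduct_comm v, h2]
    simp

/-- The increments `a + b ξ₀, b (ξ₁ - ξ₀), b (ξ₂ - ξ₁), …`. -/
def chainIncrement {n : ℕ} (a b : ℝ) (ξ : ℕ → Fin n → ℝ) : ℕ → Fin n → ℝ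
  | 0 => a • 1 + b • ξ 0
  | s + 1 => b • (ξ (s + 1) - ξ s)

/-- The matrix `∑_{s < t} u_s v_sᵀ`, where `u` are the increments of the chain `a + b ξ`. -/
def chainMatrix {n d : ℕ} (a b : ℝ) (ξ : ℕ → Fin n → ℝ) (v : ℕ → Fin d → ℝ) (t : ℕ) :
    Matrix (Fin n) (Fin d) ℝ :=
  ∑ s ∈ Finset.range t, vecMulVec (chainIncrement a b ξ s) (v s)

theorem chainIncrement_congr {n : ℕ} (a b : ℝ) {ξ ξ' : ℕ → Fin n → ℝ} {t s : ℕ}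
    (h : ∀ i < t, ξ i = ξ' i) (hs : s < t) :
    chainIncrement a b ξ s = chainIncrement a b ξ' s := by
  cases s with
  | zero => simp [chainIncrement, h 0 hs]
  | succ s => simp [chainIncrement, h (s + 1) hs, h s (by omega)]

theorem chainMatrix_congr {n d : ℕ} (a b : ℝ) {ξ ξ' : ℕ → Fin n → ℝ} {v v' : ℕ → Fin d → ℝ}
    {t : ℕ} (h : ∀ i < t, ξ i = ξ' i) (hv : ∀ i < t, v i = v' i) :
    chainMatrix a b ξ v t = chainMatrix a b ξ' v' t :=
  Finset.sum_congr rfl fun s hs => by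
    rw [chainIncrement_congr a b h (Finset.mem_range.1 hs), hv s (Finset.mem_range.1 hs)]

theorem chainMatrix_succ {n d : ℕ} (a b : ℝ) (ξ : ℕ → Fin n → ℝ) (v : ℕ → Fin d → ℝ) (t : ℕ) :
    chainMatrix a b ξ v (t + 1) =
      chainMatrix a b ξ v t + vecMulVec (chainIncrement a b ξ t) (v t) :=
  Finset.sum_range_succ _ _

theorem sum_chainIncrement {n : ℕ} (a b : ℝ) (ξ : ℕ → Fin n → ℝ) (t : ℕ) :
    ∑ s ∈ Finset.range (t + 1), chainIncrement a b ξ s = a • 1 + b • ξ t := by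
  induction t with
  | zero => simp [chainIncrement]
  | succ t ih =>
    rw [Finset.sum_range_succ, ih, chainIncrement, smul_sub]
    abel

/-- The properties of a chain of length `t` that reveals nothing about its last noise vector to
the row queries of the first `t` rounds. -/
structure IsResistingChain {n d : ℕ} (alg : TwoSidedAlgorithm n d) (a b β : ℝ)
    (ξ : ℕ → Fin n → ℝ) (v : ℕ → Fin d → ℝ) (t : ℕ) : Prop where
  dir_orth : ∀ i < t, ∀ j < t, v i ⬝ᵥ v j = if i = j then 1 else 0
  noise_orth : ∀ i < t, ∀ j < t, ξ i ⬝ᵥ ξ j = if i = j then (n : ℝ) / 2 else 0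
  one_orth : ∀ i < t, 1 ⬝ᵥ ξ i = 0
  noise_abs : ∀ i < t, ∀ l, |ξ i l| ≤ 1
  potential : ∑ l, exp (β * (∑ i ∈ Finset.range t, ξ i) l) ≤ n * exp (β ^ 2 / 2) ^ t
  hidden : ∀ i, i + 1 = t → ∀ r < t, (alg.queryAt (chainMatrix a b ξ v t) r).1 ⬝ᵥ ξ i = 0

theorem isResistingChain_zero {n d : ℕ} (alg : TwoSidedAlgorithm n d) (a b β : ℝ)
    (ξ : ℕ → Fin n → ℝ) (v : ℕ → Fin d → ℝ) : IsResistingChain alg a b β ξ v 0 where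
  dir_orth := by simp
  noise_orth := by simp
  one_orth := by simp
  noise_abs := by simp
  potential := by simp
  hidden := by simp

theorem forall_lt_succ_pair {P : ℕ → ℕ → Prop} {t : ℕ} (hP : ∀ i < t, ∀ j < t, P i j)
    (hl : ∀ i < t, P i t) (hr : ∀ i < t, P t i) (ht : P t t) :
    ∀ i < t + 1, ∀ j < t + 1, P i j := by
  intro i hi j hj
  rcases Nat.lt_succ_iff_lt_or_eq.1 hi with hi | rfl <;>
    rcases Nat.lt_succ_iff_lt_or_eq.1 hj with hj | rfl
  exacts [hP i hi j hj, hl i hi, hr j hj, ht]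

/-- The query of round `t` depends only on the first `t` responses, which the new term leaves
unchanged. It is thus known when the new vectors are chosen. -/
theorem IsResistingChain.exists_succ {n d : ℕ} {alg : TwoSidedAlgorithm n d} {a b β : ℝ}
    {ξ : ℕ → Fin n → ℝ} {v : ℕ → Fin d → ℝ} {t : ℕ} (h : IsResistingChain alg a b β ξ v t)
    (hn : 4 * t + 6 ≤ n) (hd : 2 * t + 2 ≤ d) :
    ∃ ξ' v', IsResistingChain alg a b β ξ' v' (t + 1) := by
  classical
  set A := chainMatrix a b ξ v t with hA
  set S := ∑ i ∈ Finset.range t, ξ i with hS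
  obtain ⟨w, hw1, hw⟩ := exists_unit_orthogonal
    ((Finset.range t).image v ∪ (Finset.range (t + 1)).image fun r => (alg.queryAt A r).2) (by
      have h1 := Finset.card_union_le ((Finset.range t).image v)
        ((Finset.range (t + 1)).image fun r => (alg.queryAt A r).2)
      have h2 := Finset.card_image_le (s := Finset.range t) (f := v)
      have h3 := Finset.card_image_le (s := Finset.range (t + 1))
        (f := fun r => (alg.queryAt A r).2)
      simp only [Finset.card_range] at h2 h3
      omega)
  -- At most `2t + 3` constraints: old noise, row queries, `1` and the exponential weights. This is
  -- at most `n/2`, which leaves room for squared norm `n/2`.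
  obtain ⟨x, hx, hx1, hxx⟩ := exists_cube_vector_of_sq_norm (r := (n : ℝ) / 2)
    (((Finset.range t).image ξ ∪ (Finset.range (t + 1)).image fun r => (alg.queryAt A r).1) ∪
      {1, fun l => exp (β * S l)})
    (by have : (0 : ℝ) < n := by exact_mod_cast (by omega : 0 < n)
        positivity)
    (by
      have h0 := Finset.card_union_le
        ((Finset.range t).image ξ ∪ (Finset.range (t + 1)).image fun r => (alg.queryAt A r).1)
        {1, fun l => exp (β * S l)}
      have h1 := Finset.card_union_le ((Finset.range t).image ξ)
        ((Finset.range (t + 1)).image fun r => (alg.queryAt A r).1)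
      have h2 := Finset.card_image_le (s := Finset.range t) (f := ξ)
      have h3 := Finset.card_image_le (s := Finset.range (t + 1))
        (f := fun r => (alg.queryAt A r).1)
      have h4 : ({1, fun l => exp (β * S l)} : Finset (Fin n → ℝ)).card ≤ 2 := Finset.card_le_two
      simp only [Finset.card_range] at h2 h3
      have h5 : 2 * (((Finset.range t).image ξ ∪
        (Finset.range (t + 1)).image fun r => (alg.queryAt A r).1) ∪
          {1, fun l => exp (β * S l)}).card ≤ n := by omega
      have h6 := (Nat.cast_le (α := ℝ)).2 h5
      push_cast at h6
      linarith)
  have hwv : ∀ i < t, v i ⬝ᵥ w = 0 := fun i hi =>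
    hw _ (Finset.mem_union_left _ (Finset.mem_image_of_mem _ (Finset.mem_range.2 hi)))
  have hwq : ∀ r < t + 1, (alg.queryAt A r).2 ⬝ᵥ w = 0 := fun r hr =>
    hw _ (Finset.mem_union_right _ (Finset.mem_image.2 ⟨r, Finset.mem_range.2 hr, rfl⟩))
  have hxξ : ∀ i < t, ξ i ⬝ᵥ x = 0 := fun i hi =>
    hx _ (Finset.mem_union_left _ (Finset.mem_union_left _
      (Finset.mem_image_of_mem _ (Finset.mem_range.2 hi))))
  have hxq : ∀ r < t + 1, (alg.queryAt A r).1 ⬝ᵥ x = 0 := fun r hr =>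
    hx _ (Finset.mem_union_left _ (Finset.mem_union_right _
      (Finset.mem_image.2 ⟨r, Finset.mem_range.2 hr, rfl⟩)))
  have hx_one : 1 ⬝ᵥ x = 0 := hx _ (Finset.mem_union_right _ (by simp))
  have hxS : (fun l => exp (β * S l)) ⬝ᵥ x = 0 := hx _ (Finset.mem_union_right _ (by simp))
  have hξ' : ∀ i < t, ξ i = Function.update ξ t x i := fun i hi => by simp [hi.ne]
  have hv' : ∀ i < t, v i = Function.update v t w i := fun i hi => by simp [hi.ne]
  have hsucc : chainMatrix a b (Function.update ξ t x) (Function.update v t w) (t + 1) =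
      A + vecMulVec (chainIncrement a b (Function.update ξ t x) t) w := by
    rw [chainMatrix_succ, ← chainMatrix_congr a b hξ' hv', Function.update_self]
  have hresp : ∀ r < t + 1,
      alg.responses (A + vecMulVec (chainIncrement a b (Function.update ξ t x) t) w) r =
        alg.responses A r := by
    intro r hr
    refine alg.responses_add_vecMulVec A _ w r (fun s hs => ?_) fun s hs => hwq s (by omega)
    cases t with
    | zero => omega
    | succ k =>
      -- The new increment also contains the previous noise `ξ k`, which is still hidden from these
      -- queries.
      have h1 : (alg.queryAt A s).1 ⬝ᵥ ξ k = 0 := h.hidden k rfl s (by omega)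
      simp [chainIncrement, dotProduct_sub, hxq s (by omega), h1]
  have hsum : ∑ i ∈ Finset.range t, Function.update ξ t x i = S :=
    Finset.sum_congr rfl fun i hi => (hξ' i (Finset.mem_range.1 hi)).symm
  refine ⟨Function.update ξ t x, Function.update v t w, ?_, ?_, ?_, ?_, ?_, ?_⟩
  · refine forall_lt_succ_pair (fun i hi j hj => ?_) (fun i hi => ?_) (fun i hi => ?_) ?_
    · rw [← hv' i hi, ← hv' j hj, h.dir_orth i hi j hj]
    · rw [← hv' i hi, Function.update_self, hwv i hi, if_neg hi.ne]
    · rw [← hv' i hi, Function.update_self, dotProduct_comm, hwv i hi, if_neg hi.ne']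
    · simp [hw1]
  · refine forall_lt_succ_pair (fun i hi j hj => ?_) (fun i hi => ?_) (fun i hi => ?_) ?_
    · rw [← hξ' i hi, ← hξ' j hj, h.noise_orth i hi j hj]
    · rw [← hξ' i hi, Function.update_self, hxξ i hi, if_neg hi.ne]
    · rw [← hξ' i hi, Function.update_self, dotProduct_comm, hxξ i hi, if_neg hi.ne']
    · simp [hxx]
  · intro i hi
    rcases Nat.lt_succ_iff_lt_or_eq.1 hi with hi | rfl
    · rw [← hξ' i hi, h.one_orth i hi]
    · rw [Function.update_self, hx_one]
  · intro i hi
    rcases Nat.lt_succ_iff_lt_or_eq.1 hi with hi | rfl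
    · rw [← hξ' i hi]
      exact h.noise_abs i hi
    · rwa [Function.update_self]
  · rw [Finset.sum_range_succ, hsum, Function.update_self]
    calc ∑ l, exp (β * (S + x) l) ≤ exp (β ^ 2 / 2) * ∑ l, exp (β * S l) :=
          sum_exp_add_le β S x hx1 hxS
      _ ≤ exp (β ^ 2 / 2) * (n * exp (β ^ 2 / 2) ^ t) :=
          mul_le_mul_of_nonneg_left h.potential (exp_pos _).le
      _ = _ := by ring
  · intro i hi r hr
    obtain rfl : i = t := by omega
    rw [Function.update_self, hsucc, TwoSidedAlgorithm.queryAt, hresp r hr]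
    exact hxq r hr

theorem exists_isResistingChain {n d : ℕ} (alg : TwoSidedAlgorithm n d) (a b β : ℝ) (t : ℕ)
    (hn : 4 * t + 2 ≤ n) (hd : 2 * t ≤ d) : ∃ ξ v, IsResistingChain alg a b β ξ v t := by
  induction t with
  | zero => exact ⟨0, 0, isResistingChain_zero alg a b β 0 0⟩
  | succ t ih =>
    obtain ⟨ξ, v, h⟩ := ih (by omega) (by omega)
    exact h.exists_succ (by omega) (by omega)

/-! ### Row norms and margin of the chain matrix. -/

theorem euclNorm_sq {m : ℕ} (v : Fin m → ℝ) : euclNorm v ^ 2 = v ⬝ᵥ v := by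
  rw [euclNorm, EuclideanSpace.real_norm_sq_eq]
  exact Finset.sum_congr rfl fun i _ => sq _

theorem euclNorm_le_one {m : ℕ} {v : Fin m → ℝ} (h : v ⬝ᵥ v ≤ 1) : euclNorm v ≤ 1 := by
  have h1 : euclNorm v ^ 2 ≤ 1 := (euclNorm_sq v).trans_le h
  exact (sq_le_one_iff₀ (norm_nonneg _)).1 h1

theorem sum_smul_dotProduct_self {m t : ℕ} {v : ℕ → Fin m → ℝ}
    (hv : ∀ i < t, ∀ j < t, v i ⬝ᵥ v j = if i = j then 1 else 0) (c : ℕ → ℝ) :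
    (∑ i ∈ Finset.range t, c i • v i) ⬝ᵥ (∑ i ∈ Finset.range t, c i • v i) =
      ∑ i ∈ Finset.range t, c i ^ 2 := by
  rw [sum_dotProduct]
  refine Finset.sum_congr rfl fun i hi => ?_
  rw [dotProduct_sum, Finset.sum_eq_single_of_mem i hi]
  · rw [smul_dotProduct, dotProduct_smul, hv i (Finset.mem_range.1 hi) i (Finset.mem_range.1 hi),
      if_pos rfl, smul_eq_mul, smul_eq_mul, mul_one, sq]
  · intro j hj hji
    rw [smul_dotProduct, dotProduct_smul, hv i (Finset.mem_range.1 hi) j (Finset.mem_range.1 hj),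
      if_neg hji.symm, smul_zero, smul_zero]

theorem chainMatrix_row {n d : ℕ} (a b : ℝ) (ξ : ℕ → Fin n → ℝ) (v : ℕ → Fin d → ℝ) (t : ℕ)
    (l : Fin n) :
    chainMatrix a b ξ v t l = ∑ s ∈ Finset.range t, chainIncrement a b ξ s l • v s := by
  ext j
  simp [chainMatrix, Matrix.sum_apply, vecMulVec_apply]

theorem chainMatrix_mulVec {n d : ℕ} (a b : ℝ) (ξ : ℕ → Fin n → ℝ) (v : ℕ → Fin d → ℝ) (t : ℕ)
    (w : Fin d → ℝ) :
    chainMatrix a b ξ v t *ᵥ w =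
      ∑ s ∈ Finset.range t, (v s ⬝ᵥ w) • chainIncrement a b ξ s := by
  simp [chainMatrix, sum_mulVec, vecMulVec_mulVec]

theorem abs_chainIncrement_le {n : ℕ} {a b : ℝ} {ξ : ℕ → Fin n → ℝ} {t : ℕ} (ha : 0 ≤ a)
    (hab : a ≤ b) (hξ : ∀ i < t, ∀ l, |ξ i l| ≤ 1) {s : ℕ} (hs : s < t) (l : Fin n) :
    |chainIncrement a b ξ s l| ≤ 2 * b := by
  have hb : 0 ≤ b := ha.trans hab
  cases s with
  | zero =>
    have h := abs_le.1 (hξ 0 hs l)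
    simp only [chainIncrement, Pi.add_apply, Pi.smul_apply, Pi.one_apply, smul_eq_mul]
    rw [abs_le]
    constructor <;> nlinarith
  | succ s =>
    have h := abs_le.1 (hξ (s + 1) hs l)
    have h' := abs_le.1 (hξ s (by omega) l)
    simp only [chainIncrement, Pi.sub_apply, Pi.smul_apply, smul_eq_mul]
    rw [abs_le]
    constructor <;> nlinarith

theorem euclNorm_chainMatrix_row_le_one {n d : ℕ} {a b : ℝ} {ξ : ℕ → Fin n → ℝ}
    {v : ℕ → Fin d → ℝ} {t : ℕ} (ha : 0 ≤ a) (hab : a ≤ b) (hb : 4 * b ^ 2 * t ≤ 1)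
    (hv : ∀ i < t, ∀ j < t, v i ⬝ᵥ v j = if i = j then 1 else 0)
    (hξ : ∀ i < t, ∀ l, |ξ i l| ≤ 1) (l : Fin n) :
    euclNorm (chainMatrix a b ξ v t l) ≤ 1 := by
  refine euclNorm_le_one ?_
  rw [chainMatrix_row, sum_smul_dotProduct_self hv]
  calc ∑ i ∈ Finset.range t, chainIncrement a b ξ i l ^ 2
      ≤ ∑ i ∈ Finset.range t, (2 * b) ^ 2 := Finset.sum_le_sum fun i hi =>
        sq_le_sq' (abs_le.1 (abs_chainIncrement_le ha hab hξ (Finset.mem_range.1 hi) l)).1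
          (abs_le.1 (abs_chainIncrement_le ha hab hξ (Finset.mem_range.1 hi) l)).2
    _ = 4 * b ^ 2 * t := by simp; ring
    _ ≤ 1 := hb

theorem le_margin_of_forall_le {n d : ℕ} [NeZero n] {A : Matrix (Fin n) (Fin d) ℝ} {γ : ℝ}
    {w : Fin d → ℝ} (hw : w ⬝ᵥ w ≤ 1) (h : ∀ l, γ ≤ (A *ᵥ w) l) : γ ≤ margin A := by
  refine le_trans ?_ ((margin_isGreatest A).2 ⟨w, euclNorm_le_one hw, rfl⟩)
  rw [minPayoff_eq_iInf]
  exact le_ciInf h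

theorem le_margin_chainMatrix {n d : ℕ} [NeZero n] {a b : ℝ} {ξ : ℕ → Fin n → ℝ}
    {v : ℕ → Fin d → ℝ} {t : ℕ}
    (hv : ∀ i < t + 1, ∀ j < t + 1, v i ⬝ᵥ v j = if i = j then 1 else 0) (hξ : ξ t = 0) :
    a / √(t + 1) ≤ margin (chainMatrix a b ξ v (t + 1)) := by
  have ht : (0 : ℝ) < t + 1 := by positivity
  refine le_margin_of_forall_le
    (w := ∑ s ∈ Finset.range (t + 1), (√((t : ℝ) + 1))⁻¹ • v s) ?_ fun l => ?_
  · rw [sum_smul_dotProduct_self hv fun _ => (√((t : ℝ) + 1))⁻¹]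
    simp [inv_pow, Real.sq_sqrt ht.le, ht.ne']
  · refine le_of_eq ?_
    have h1 : ∀ s ∈ Finset.range (t + 1),
        (v s ⬝ᵥ ∑ i ∈ Finset.range (t + 1), (√((t : ℝ) + 1))⁻¹ • v i) •
          chainIncrement a b ξ s = (√((t : ℝ) + 1))⁻¹ • chainIncrement a b ξ s := by
      intro s hs
      rw [dotProduct_sum, Finset.sum_eq_single_of_mem s hs]
      · rw [dotProduct_smul, hv s (Finset.mem_range.1 hs) s (Finset.mem_range.1 hs)]
        simp
      · intro j hj hjs
        rw [dotProduct_smul, hv s (Finset.mem_range.1 hs) j (Finset.mem_range.1 hj),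
          if_neg hjs.symm, smul_zero]
    rw [chainMatrix_mulVec, Finset.sum_congr rfl h1, ← Finset.smul_sum, sum_chainIncrement, hξ]
    simp [div_eq_inv_mul]

/-! ### The distribution certifying failure. -/

theorem minPayoff_nonpos_of_dotProduct_eq_zero {n d : ℕ} [NeZero n]
    {A : Matrix (Fin n) (Fin d) ℝ} {w : Fin d → ℝ} {q : Fin n → ℝ}
    (hq : q ∈ stdSimplex ℝ (Fin n)) (h : q ⬝ᵥ (A *ᵥ w) = 0) : minPayoff A w ≤ 0 :=
  (minPayoff_isLeast A w).2 ⟨q, hq, h⟩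

/-- The distribution `(1 - S / R) / n`, where `S` is the sum of the noise vectors, is orthogonal
to every increment of the chain with `a / b = 1 / (2 R)`. -/
theorem dotProduct_chainIncrement_eq_zero {n : ℕ} [NeZero n] {a b R : ℝ} {ξ : ℕ → Fin n → ℝ}
    {t : ℕ} (hab : a = b / (2 * R))
    (hξ : ∀ i < t, ∀ j < t, ξ i ⬝ᵥ ξ j = if i = j then (n : ℝ) / 2 else 0)
    (hone : ∀ i < t, 1 ⬝ᵥ ξ i = 0) {s : ℕ} (hs : s < t) :
    ((n : ℝ)⁻¹ • (1 - R⁻¹ • ∑ i ∈ Finset.range t, ξ i)) ⬝ᵥ chainIncrement a b ξ s = 0 := by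
  have hn : (n : ℝ) ≠ 0 := by exact_mod_cast NeZero.ne n
  have hS : ∀ j < t, (∑ i ∈ Finset.range t, ξ i) ⬝ᵥ ξ j = n / 2 := by
    intro j hj
    rw [sum_dotProduct, Finset.sum_eq_single_of_mem j (Finset.mem_range.2 hj)]
    · rw [hξ j hj j hj, if_pos rfl]
    · intro i hi hij
      rw [hξ i (Finset.mem_range.1 hi) j hj, if_neg hij]
  have hSone : (∑ i ∈ Finset.range t, ξ i) ⬝ᵥ 1 = 0 := by
    rw [sum_dotProduct]
    exact Finset.sum_eq_zero fun i hi => by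
      rw [dotProduct_comm, hone i (Finset.mem_range.1 hi)]
  have hone1 : (1 : Fin n → ℝ) ⬝ᵥ 1 = n := by simp
  cases s with
  | zero =>
    simp only [chainIncrement, smul_dotProduct, sub_dotProduct, dotProduct_add, dotProduct_smul,
      hS 0 hs, hSone, hone1, hone 0 hs, smul_eq_mul, hab]
    field_simp
    ring
  | succ s =>
    simp only [chainIncrement, smul_dotProduct, sub_dotProduct, dotProduct_sub, dotProduct_smul,
      hS (s + 1) hs, hS s (by omega), hone (s + 1) hs, hone s (by omega), smul_eq_mul]
    ring

theorem sub_smul_mem_stdSimplex {n : ℕ} [NeZero n] {R : ℝ} (hR : 0 < R) {S : Fin n → ℝ}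
    (hS : ∀ l, S l ≤ R) (hone : 1 ⬝ᵥ S = 0) :
    (n : ℝ)⁻¹ • (1 - R⁻¹ • S) ∈ stdSimplex ℝ (Fin n) := by
  have hn : (n : ℝ) ≠ 0 := by exact_mod_cast NeZero.ne n
  refine ⟨fun l => ?_, ?_⟩
  · have h : R⁻¹ * S l ≤ 1 := by
      rw [inv_mul_le_iff₀ hR, mul_one]
      exact hS l
    simp only [Pi.smul_apply, Pi.sub_apply, Pi.one_apply, smul_eq_mul]
    exact mul_nonneg (by positivity) (by linarith)
  · rw [← one_dotProduct, dotProduct_smul, dotProduct_sub, dotProduct_smul, hone]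
    simp [hn]

/-- For `β = R / t` one has `t β² / 2 = log n`, so the potential is at most `n²`, and `β S l ≤ 2 log
n = β R`. -/
theorem IsResistingChain.sum_noise_le {n d : ℕ} [NeZero n] {alg : TwoSidedAlgorithm n d}
    {a b R : ℝ} {ξ : ℕ → Fin n → ℝ} {v : ℕ → Fin d → ℝ} {t : ℕ}
    (h : IsResistingChain alg a b (R / t) ξ v t) (ht : 0 < t) (hR : 0 < R)
    (hR2 : R ^ 2 = 2 * t * Real.log n) (l : Fin n) :
    (∑ i ∈ Finset.range t, ξ i) l ≤ R := by
  have hn : (0 : ℝ) < n := by exact_mod_cast NeZero.pos n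
  have ht' : (0 : ℝ) < t := by exact_mod_cast ht
  set S := ∑ i ∈ Finset.range t, ξ i
  have h1 : exp (R / t * S l) ≤ n * exp ((R / t) ^ 2 / 2) ^ t :=
    (Finset.single_le_sum (f := fun l => exp (R / t * S l)) (fun _ _ => (exp_pos _).le)
      (Finset.mem_univ l)).trans h.potential
  have h2 : (t : ℝ) * ((R / t) ^ 2 / 2) = Real.log n := by
    rw [div_pow, hR2]
    field_simp
  rw [← Real.exp_nat_mul, h2, Real.exp_log hn] at h1
  have h3 : R / t * S l ≤ 2 * Real.log n := by
    have := Real.log_le_log (exp_pos _) h1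
    rw [Real.log_exp, Real.log_mul hn.ne' hn.ne'] at this
    linarith
  have h4 : R / t * R = 2 * Real.log n := by
    rw [div_mul_eq_mul_div, ← sq, hR2]
    field_simp
  rw [← h4] at h3
  exact le_of_mul_le_mul_left h3 (by positivity)

/-! ### The resisting matrix and the choice of constants. -/

/-- Every deterministic two-sided algorithm fails after `t ≥ 1` rounds on some matrix with margin
of order `1 / (t √(t log n))`. -/
theorem TwoSidedAlgorithm.exists_resisting_matrix {n d : ℕ} (alg : TwoSidedAlgorithm n d) (t : ℕ)
    (ht : 0 < t) (hn : 4 * t + 2 ≤ n) (hd : 2 * t + 2 ≤ d) :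
    ∃ A : Matrix (Fin n) (Fin d) ℝ, (∀ l, euclNorm (A l) ≤ 1) ∧
      1 / (16 * t * √(t * Real.log n)) ≤ margin A ∧ minPayoff A (alg.result A t) ≤ 0 := by
  classical
  have : NeZero n := ⟨by omega⟩
  have ht1 : (1 : ℝ) ≤ t := by exact_mod_cast ht
  have hlog : 1 ≤ Real.log n := by
    have h3 : (3 : ℝ) ≤ n := by exact_mod_cast (by omega : 3 ≤ n)
    rw [Real.le_log_iff_exp_le (by linarith)]
    linarith [Real.exp_one_lt_d9]
  have htl : 1 ≤ t * Real.log n := one_le_mul_of_one_le_of_one_le ht1 hlog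
  set R := √(2 * t * Real.log n) with hR
  have hR2 : R ^ 2 = 2 * t * Real.log n := Real.sq_sqrt (by positivity)
  have hR1 : 1 ≤ R := by
    rw [hR, Real.one_le_sqrt]
    linarith
  have hR0 : 0 < R := by linarith
  have hs0 : 0 < √((t : ℝ) + 1) := by positivity
  -- This makes the row bound `4 b² (t + 1)` equal to `1`.
  set b := 1 / (2 * √((t : ℝ) + 1)) with hb
  set a := b / (2 * R) with ha
  have hb0 : 0 < b := by positivity
  have ha0 : 0 < a := by positivity
  have hab : a ≤ b := div_le_self hb0.le (by linarith)
  obtain ⟨ξ, v, h⟩ := exists_isResistingChain alg a b (R / t) t hn (by omega)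
  set A := chainMatrix a b ξ v t with hA
  obtain ⟨w, hw1, hw⟩ := exists_unit_orthogonal
    (insert (alg.result A t)
      ((Finset.range t).image v ∪ (Finset.range t).image fun r => (alg.queryAt A r).2)) (by
      have h0 := Finset.card_insert_le (alg.result A t)
        ((Finset.range t).image v ∪ (Finset.range t).image fun r => (alg.queryAt A r).2)
      have h1 := Finset.card_union_le ((Finset.range t).image v)
        ((Finset.range t).image fun r => (alg.queryAt A r).2)
      have h2 := Finset.card_image_le (s := Finset.range t) (f := v)
      have h3 := Finset.card_image_le (s := Finset.range t) (f := fun r => (alg.queryAt A r).2)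
      simp only [Finset.card_range] at h2 h3
      omega)
  have hwv : ∀ i < t, v i ⬝ᵥ w = 0 := fun i hi =>
    hw _ (Finset.mem_insert_of_mem (Finset.mem_union_left _
      (Finset.mem_image_of_mem _ (Finset.mem_range.2 hi))))
  have hwq : ∀ r < t, (alg.queryAt A r).2 ⬝ᵥ w = 0 := fun r hr =>
    hw _ (Finset.mem_insert_of_mem (Finset.mem_union_right _
      (Finset.mem_image.2 ⟨r, Finset.mem_range.2 hr, rfl⟩)))
  have hwo : alg.result A t ⬝ᵥ w = 0 := hw _ (Finset.mem_insert_self _ _)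
  -- Ending the chain at zero noise telescopes the increments to `a • 1`; the last increment `-b
  -- ξ_{t-1}` is still hidden.
  set ξ' := Function.update ξ t 0 with hξ'
  set v' := Function.update v t w with hv'
  have hξ : ∀ i < t, ξ i = ξ' i := fun i hi => by simp [hξ', hi.ne]
  have hv : ∀ i < t, v i = v' i := fun i hi => by simp [hv', hi.ne]
  have hξt : ξ' t = 0 := Function.update_self ..
  have hvt : v' t = w := Function.update_self ..
  have hsucc : chainMatrix a b ξ' v' (t + 1) = A + vecMulVec (chainIncrement a b ξ' t) w := by
    rw [chainMatrix_succ, ← chainMatrix_congr a b hξ hv, hvt]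
  have hresult : alg.result (chainMatrix a b ξ' v' (t + 1)) t = alg.result A t := by
    rw [hsucc, TwoSidedAlgorithm.result, TwoSidedAlgorithm.result,
      alg.responses_add_vecMulVec A _ w t (fun s hs => ?_) hwq]
    obtain ⟨k, rfl⟩ : ∃ k, t = k + 1 := ⟨t - 1, by omega⟩
    have h1 : (alg.queryAt A s).1 ⬝ᵥ ξ k = 0 := h.hidden k rfl s hs
    simp [chainIncrement, hξt, ← hξ k (by omega), h1]
  have hv_orth : ∀ i < t + 1, ∀ j < t + 1, v' i ⬝ᵥ v' j = if i = j then 1 else 0 := by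
    refine forall_lt_succ_pair (fun i hi j hj => ?_) (fun i hi => ?_) (fun i hi => ?_) ?_
    · rw [← hv i hi, ← hv j hj, h.dir_orth i hi j hj]
    · rw [← hv i hi, hvt, hwv i hi, if_neg hi.ne]
    · rw [← hv i hi, hvt, dotProduct_comm, hwv i hi, if_neg hi.ne']
    · rw [hvt, hw1, if_pos rfl]
  refine ⟨chainMatrix a b ξ' v' (t + 1), ?_, ?_, ?_⟩
  · refine euclNorm_chainMatrix_row_le_one ha0.le hab (le_of_eq ?_) hv_orth fun i hi l => ?_
    · rw [hb, div_pow, mul_pow, Real.sq_sqrt (by positivity)]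
      push_cast
      field_simp
      norm_num
    · rcases Nat.lt_succ_iff_lt_or_eq.1 hi with hi | rfl
      · rw [← hξ i hi]
        exact h.noise_abs i hi l
      · simp [hξt]
  · refine le_trans ?_ (le_margin_chainMatrix hv_orth hξt)
    have h1 : a / √((t : ℝ) + 1) = 1 / (4 * (t + 1) * R) := by
      have hss := Real.mul_self_sqrt (show (0 : ℝ) ≤ t + 1 by positivity)
      have hden : 2 * √((t : ℝ) + 1) * (2 * R * √((t : ℝ) + 1)) = 4 * (t + 1) * R := by
        linear_combination 4 * R * hss
      rw [ha, hb, div_div, div_div, ← hden]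
    have h2 : R ≤ 2 * √(t * Real.log n) := by
      refine abs_le_of_sq_le_sq' ?_ (by positivity) |>.2
      rw [hR2, mul_pow, Real.sq_sqrt (by positivity)]
      linarith
    rw [h1]
    refine one_div_le_one_div_of_le (by positivity) ?_
    calc 4 * ((t : ℝ) + 1) * R ≤ 4 * (t + t) * (2 * √(t * Real.log n)) := by gcongr
      _ = 16 * t * √(t * Real.log n) := by ring
  · rw [hresult]
    have hone : 1 ⬝ᵥ ∑ i ∈ Finset.range t, ξ i = 0 := by
      rw [dotProduct_sum]
      exact Finset.sum_eq_zero fun i hi => h.one_orth i (Finset.mem_range.1 hi)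
    refine minPayoff_nonpos_of_dotProduct_eq_zero
      (sub_smul_mem_stdSimplex hR0 (h.sum_noise_le ht hR0 hR2) hone) ?_
    rw [chainMatrix_mulVec, dotProduct_sum]
    refine Finset.sum_eq_zero fun s hs => ?_
    rcases Nat.lt_succ_iff_lt_or_eq.1 (Finset.mem_range.1 hs) with hs | rfl
    · rw [dotProduct_smul, ← chainIncrement_congr a b hξ hs,
        dotProduct_chainIncrement_eq_zero ha h.noise_orth h.one_orth hs, smul_zero]
    · rw [hvt, dotProduct_comm w, hwo, zero_smul, dotProduct_zero]

/-- Covers `T = 0`: all rows equal one unit vector orthogonal to the output. -/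
theorem exists_unit_rows_minPayoff_nonpos {n d : ℕ} [NeZero n] (hd : 2 ≤ d) (w : Fin d → ℝ) :
    ∃ A : Matrix (Fin n) (Fin d) ℝ, (∀ l, euclNorm (A l) ≤ 1) ∧ 1 ≤ margin A ∧
      minPayoff A w ≤ 0 := by
  obtain ⟨v, hv1, hv⟩ := exists_unit_orthogonal {w} (by rw [Finset.card_singleton]; omega)
  have hwv : v ⬝ᵥ w = 0 := by
    rw [dotProduct_comm]
    exact hv w (by simp)
  refine ⟨Matrix.of fun _ => v, fun l => euclNorm_le_one hv1.le,
    le_margin_of_forall_le hv1.le fun l => hv1.ge, ?_⟩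
  rw [minPayoff_eq_iInf]
  exact (ciInf_le (Set.finite_range _).bddBelow 0).trans hwv.le

theorem theorem2 :
    ∃ c : ℝ, 0 < c ∧
      (∀ T d n : ℕ, c < (T : ℝ) → c * (T : ℝ) < (d : ℝ) →
        c * (T : ℝ) ^ 2 * Real.log (T : ℝ) < (n : ℝ) →
        ∀ alg : TwoSidedAlgorithm n d, ∃ A : Matrix (Fin n) (Fin d) ℝ,
          (∀ l : Fin n, euclNorm (A l) ≤ 1) ∧
          1 / (c * (T : ℝ) * Real.sqrt ((T : ℝ) * Real.log (n : ℝ))) ≤ margin A ∧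
          minPayoff A (alg.result A T) ≤ 0) ∧
      (∀ γ : ℝ, 0 < γ → γ ≤ 1 / c → ∀ d n : ℕ,
        c * γ ^ (-(2 / 3) : ℝ) < (d : ℝ) →
        c * γ ^ (-(4 / 3) : ℝ) * Real.log (1 / γ) < (n : ℝ) →
        ∀ (T : ℕ) (alg : TwoSidedAlgorithm n d),
          (∀ A : Matrix (Fin n) (Fin d) ℝ, (∀ l : Fin n, euclNorm (A l) ≤ 1) →
            γ ≤ margin A → 0 < minPayoff A (alg.result A T)) →
          (1 / c) * γ ^ (-(2 / 3) : ℝ) * Real.log (n : ℝ) ^ (-(1 / 3) : ℝ) ≤ (T : ℝ)) := by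
  have exp_one_le : exp 1 ≤ 16 := by linarith [Real.exp_one_lt_d9]
  refine ⟨16, by norm_num, ?_, ?_⟩
  · intro T d n hT hd hn alg
    have hT' : 0 < T := by exact_mod_cast (by linarith : (0 : ℝ) < T)
    have hlog : 1 ≤ Real.log T := by
      rw [Real.le_log_iff_exp_le (by linarith)]
      linarith
    have hn' : 16 * (T : ℝ) ^ 2 < n :=
      (le_mul_of_one_le_right (by positivity) hlog).trans_lt hn
    refine alg.exists_resisting_matrix T hT' ?_ ?_
    · have h : (4 * T + 2 : ℝ) ≤ n := by nlinarith
      exact_mod_cast h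
    · have h : (2 * T + 2 : ℝ) ≤ d := by linarith
      exact_mod_cast h
  · intro γ hγ hγc d n hd hn T alg halg
    by_contra! hlt
    have hγ1 : γ ≤ 1 := hγc.trans (by norm_num)
    set g := γ ^ (-(2 / 3) : ℝ) with hg
    have hg1 : 1 ≤ g := Real.one_le_rpow_of_pos_of_le_one_of_nonpos hγ hγ1 (by norm_num)
    have hg2 : γ ^ (-(4 / 3) : ℝ) = g ^ 2 := by
      rw [hg, ← Real.rpow_natCast, ← Real.rpow_mul hγ.le]
      norm_num
    have hg3 : γ ^ 2 * g ^ 3 = 1 := by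
      rw [hg, ← Real.rpow_natCast (γ ^ _), ← Real.rpow_mul hγ.le, ← Real.rpow_natCast,
        ← Real.rpow_add hγ]
      norm_num
    have hlogγ : 1 ≤ Real.log (1 / γ) := by
      rw [Real.le_log_iff_exp_le (by positivity)]
      exact exp_one_le.trans ((le_one_div (by norm_num) hγ).2 hγc)
    have hng : 16 * g ^ 2 < n := by
      rw [hg2] at hn
      exact (le_mul_of_one_le_right (by positivity) hlogγ).trans_lt hn
    have hgg : g ≤ g ^ 2 := le_self_pow₀ hg1 (by norm_num)
    have hn16 : (16 : ℝ) < n := by linarith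
    have hd2 : 2 ≤ d := by
      have : (2 : ℝ) ≤ d := by linarith
      exact_mod_cast this
    have : NeZero n := ⟨by rintro rfl; norm_num at hn16⟩
    have hL : 1 ≤ Real.log n := by
      rw [Real.le_log_iff_exp_le (by linarith)]
      linarith
    rcases Nat.eq_zero_or_pos T with rfl | hT
    · obtain ⟨A, hA, hm, hp⟩ :=
        exists_unit_rows_minPayoff_nonpos (n := n) hd2 (alg.output [])
      exact absurd (halg A hA (hγ1.trans hm)) hp.not_gt
    · have hT1 : (1 : ℝ) ≤ T := by exact_mod_cast hT
      set k := Real.log n ^ (-(1 / 3) : ℝ) with hk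
      have hk0 : 0 < k := Real.rpow_pos_of_pos (by linarith) _
      have hk1 : k ≤ 1 := Real.rpow_le_one_of_one_le_of_nonpos hL (by norm_num)
      have hk3 : k ^ 3 * Real.log n = 1 := by
        rw [hk, ← Real.rpow_natCast, ← Real.rpow_mul (by linarith),
          show (-(1 / 3) : ℝ) * (3 : ℕ) = -1 by norm_num, Real.rpow_neg_one]
        exact inv_mul_cancel₀ (by linarith : 0 < Real.log n).ne'
      have hTg : 16 * (T : ℝ) < g := by
        have : g * k ≤ g := mul_le_of_le_one_right (by linarith) hk1
        linarith
      obtain ⟨A, hA, hm, hp⟩ := alg.exists_resisting_matrix T hT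
        (by have h : (4 * T + 2 : ℝ) ≤ n := by linarith
            exact_mod_cast h)
        (by have h : (2 * T + 2 : ℝ) ≤ d := by linarith
            exact_mod_cast h)
      refine absurd (halg A hA (le_trans ?_ hm)) hp.not_gt
      rw [le_one_div hγ (by positivity)]
      -- After squaring, the claim is `256 T³ log n ≤ γ⁻² = g³`, which follows from `T < g k / 16`
      -- and `k³ log n = 1`.
      refine abs_le_of_sq_le_sq' ?_ (by positivity) |>.2
      have hT3 : (T : ℝ) ^ 3 ≤ (1 / 16 * g * k) ^ 3 := by gcongr
      rw [mul_pow, mul_pow, Real.sq_sqrt (by positivity)]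
      calc (16 : ℝ) ^ 2 * (T : ℝ) ^ 2 * (T * Real.log n)
          = 16 ^ 2 * T ^ 3 * Real.log n := by ring
        _ ≤ 16 ^ 2 * (1 / 16 * g * k) ^ 3 * Real.log n := by gcongr
        _ = 1 / 16 * g ^ 3 * (k ^ 3 * Real.log n) := by ring
        _ ≤ g ^ 3 := by
          rw [hk3]
          have : 0 < g ^ 3 := by positivity
          linarith
        _ = (1 / γ) ^ 2 := by
          rw [div_pow, one_pow, eq_div_iff (by positivity), mul_comm, hg3]
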